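/- For a set $S\subseteq\mathbb{R}^2$, let $L(S)$ be the set of all lines passing through two distinct points of $S$, and let $$\mathcal T(S)=\bigcup_{\ell,m\in L(S),\ \ell\neq m}(\ell\cap m)\subseteq\mathbb{R}^2$$ be the set of intersection points of pairs of distinct lines in $L(S)$; in particular $\mathcal T(S)=\emptyset$ if $S$ is empty or its points are collinear. Put $\mathcal T^0(S)=S$ and $\mathcal T^{i+1}(S)=\mathcal T(\mathcal T^i(S))$. The order of $S$ is the smallest positive integer $n$ such that $\mathcal T^n(S)=\mathcal T^{n-1}(S)$, and it is $\infty$ if there is no such $n$. **Theorem.** Let $S$ be a finite set of points in the plane $\mathbb{R}^2$. Then $S$ has infinite order if and only if $\bigcup_{i\ge 0}\mathcal T^i(S)$ is dense in $\mathbb{R}^2$. -/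

import Mathlib

/-- The lines passing through two distinct points of `S`. -/
def connectingLines (S : Set (EuclideanSpace ℝ (Fin 2))) :
    Set (AffineSubspace ℝ (EuclideanSpace ℝ (Fin 2))) :=
  {L | ∃ p ∈ S, ∃ q ∈ S, p ≠ q ∧ L = affineSpan ℝ {p, q}}

/-- The operation `T`: all intersection points of two distinct connecting lines of `S`.
It is empty when `S` is empty or collinear, since then there is at most one such line. -/
def lineIntersections (S : Set (EuclideanSpace ℝ (Fin 2))) : Set (EuclideanSpace ℝ (Fin 2)) :=
  {x | ∃ L ∈ connectingLines S, ∃ M ∈ connectingLines S, L ≠ M ∧ x ∈ L ∧ x ∈ M}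

/-- The order of `S`: the smallest positive integer `n` with `T^n(S) = T^(n-1)(S)`, and `⊤`
(the infimum of the empty set in `ℕ∞`) if there is no such `n`. -/
noncomputable def lineOrder (S : Set (EuclideanSpace ℝ (Fin 2))) : ℕ∞ :=
  sInf {m : ℕ∞ | ∃ n : ℕ, 0 < n ∧ lineIntersections^[n] S = lineIntersections^[n - 1] S ∧
    m = (n : ℕ∞)}

/-!
Let `U` be the union of the iterates of `S`. If the order of `S` is finite, then `U` is finite, hence
not dense. Suppose that the order is infinite. Then `S` is not collinear, so the iterates increase,
`U` is infinite, and `U` is closed under `lineIntersections`.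

A non-collinear set is fixed by `lineIntersections` when all its points but one lie on a line.
Otherwise it contains four points in general position (`nearPencil_or_hasGeneralQuadruple`). If these
are not the vertices of a parallelogram, then `U` contains a triangle together with a point of its
interior: either one of the four points is inside the triangle of the other three, or they form a
convex quadrilateral, and two opposite sides meet in a point `e` such that `e` and two of the vertices
form a triangle around the crossing of the diagonals (`hasInteriorPoint_of_isGenericCoord`). If they
form a parallelogram, then the infinite set `U` has a point besides the vertices and the centre, and
this point forms a quadrilateral of the former kind with three of the vertices
(`hasInteriorPoint_of_parallelogram`).

A triangle `a b c` with an inner point is a projective frame, and in the corresponding homogeneous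
coordinates the line at infinity has an equation with positive coefficients. So vectors with
nonnegative coordinates represent genuine points, and the classical constructions of sums and
quotients can be carried out with them: all positive rational vectors represent points of `U`
(`positive_rational_mem`). Every rational vector off the line at infinity is then the intersection of
two lines joining positive rational points (`rational_mem`), and the points with rational coordinates
in a projective frame are dense (`dense_of_hasInteriorPoint`).
-/

/-! ### Signed areas and lines -/

/-- Twice the signed area of the triangle `p q r`; it vanishes exactly when the three points are
collinear. -/
def signedArea (p q r : EuclideanSpace ℝ (Fin 2)) : ℝ :=
  (q 0 - p 0) * (r 1 - p 1) - (q 1 - p 1) * (r 0 - p 0)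

theorem mem_line_iff_signedArea {p q : EuclideanSpace ℝ (Fin 2)} (hpq : p ≠ q)
    (x : EuclideanSpace ℝ (Fin 2)) : x ∈ affineSpan ℝ {p, q} ↔ signedArea p q x = 0 := by
  rw [mem_affineSpan_pair_iff_exists_lineMap_eq]
  constructor
  · rintro ⟨t, rfl⟩
    simp only [signedArea, AffineMap.lineMap_apply, vsub_eq_sub, vadd_eq_add, PiLp.add_apply,
      PiLp.smul_apply, PiLp.sub_apply, smul_eq_mul]
    ring
  · intro h
    unfold signedArea at h
    by_cases h0 : q 0 = p 0
    · have h1 : q 1 - p 1 ≠ 0 := fun h1 => hpq (by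
        ext i; fin_cases i
        · exact h0.symm
        · exact (sub_eq_zero.mp h1).symm)
      refine ⟨(x 1 - p 1) / (q 1 - p 1), ?_⟩
      have hx : x 0 = p 0 := by
        rw [h0, sub_self, zero_mul, zero_sub, neg_eq_zero, mul_eq_zero] at h
        exact sub_eq_zero.mp (h.resolve_left h1)
      ext i; fin_cases i <;> simp [AffineMap.lineMap_apply, h0, hx, h1]
    · have h1 : q 0 - p 0 ≠ 0 := sub_ne_zero.mpr h0
      refine ⟨(x 0 - p 0) / (q 0 - p 0), ?_⟩
      ext i; fin_cases i
      · simp [AffineMap.lineMap_apply, h1]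
      · simp only [AffineMap.lineMap_apply, vsub_eq_sub, vadd_eq_add, Fin.mk_one, PiLp.add_apply,
          PiLp.smul_apply, PiLp.sub_apply, smul_eq_mul]
        field_simp
        linarith

theorem signedArea_self_left (p r : EuclideanSpace ℝ (Fin 2)) : signedArea p p r = 0 := by
  simp [signedArea]

theorem signedArea_rotate (p q r : EuclideanSpace ℝ (Fin 2)) :
    signedArea q r p = signedArea p q r := by
  unfold signedArea; ring

theorem signedArea_swap (p q r : EuclideanSpace ℝ (Fin 2)) :
    signedArea q p r = -signedArea p q r := by
  unfold signedArea; ring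

theorem line_eq_of_mem {p q x y : EuclideanSpace ℝ (Fin 2)} (hpq : p ≠ q) (hxy : x ≠ y)
    (hx : signedArea p q x = 0) (hy : signedArea p q y = 0) :
    affineSpan ℝ {x, y} = affineSpan ℝ {p, q} := by
  have hx' := (mem_line_iff_signedArea hpq x).2 hx
  have hy' := (mem_line_iff_signedArea hpq y).2 hy
  exact affineSpan_pair_eq_of_mem_of_mem_of_ne hx' hy' hxy

/-- Every point of the plane is an affine combination of the vertices of a nondegenerate
triangle (Cramer's rule). -/
theorem exists_barycentric {a b c : EuclideanSpace ℝ (Fin 2)} (h : signedArea a b c ≠ 0)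
    (x : EuclideanSpace ℝ (Fin 2)) :
    ∃ l m n : ℝ, l + m + n = 1 ∧ x = l • a + m • b + n • c := by
  refine ⟨signedArea x b c / signedArea a b c, signedArea a x c / signedArea a b c,
    signedArea a b x / signedArea a b c, ?_, ?_⟩
  · field_simp
    unfold signedArea; ring
  · ext i
    fin_cases i <;>
    · simp only [Fin.zero_eta, Fin.mk_one, PiLp.add_apply, PiLp.smul_apply, smul_eq_mul]
      field_simp
      unfold signedArea; ring

/-- The signed area of three affine combinations of `a, b, c` is the determinant of their
barycentric coordinates times the signed area of `a b c`. -/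
theorem signedArea_combination (a b c : EuclideanSpace ℝ (Fin 2))
    {l₁ m₁ n₁ l₂ m₂ n₂ l₃ m₃ n₃ : ℝ} (h₁ : l₁ + m₁ + n₁ = 1) (h₂ : l₂ + m₂ + n₂ = 1)
    (h₃ : l₃ + m₃ + n₃ = 1) :
    signedArea (l₁ • a + m₁ • b + n₁ • c) (l₂ • a + m₂ • b + n₂ • c) (l₃ • a + m₃ • b + n₃ • c) =
      (l₁ * (m₂ * n₃ - n₂ * m₃) - m₁ * (l₂ * n₃ - n₂ * l₃) + n₁ * (l₂ * m₃ - m₂ * l₃)) *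
        signedArea a b c := by
  obtain rfl : l₁ = 1 - m₁ - n₁ := by linarith
  obtain rfl : l₂ = 1 - m₂ - n₂ := by linarith
  obtain rfl : l₃ = 1 - m₃ - n₃ := by linarith
  simp only [signedArea, PiLp.add_apply, PiLp.smul_apply, smul_eq_mul]
  ring

/-- In a set closed under line intersections, the intersection `x` of the lines `p q` and `r s`
belongs to the set. The hypothesis that `r` is off the line `p q` makes the lines distinct; the
case `r = s` is harmless, since then `x = r`. -/
theorem mem_of_mem_lines {U : Set (EuclideanSpace ℝ (Fin 2))} (hU : lineIntersections U ⊆ U)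
    {p q r s x : EuclideanSpace ℝ (Fin 2)} (hp : p ∈ U) (hq : q ∈ U) (hr : r ∈ U) (hs : s ∈ U)
    (h : signedArea p q r ≠ 0) (hx : x ∈ affineSpan ℝ {p, q}) (hx' : x ∈ affineSpan ℝ {r, s}) :
    x ∈ U := by
  have hpq : p ≠ q := by rintro rfl; exact h (signedArea_self_left _ _)
  by_cases hrs : r = s
  · subst hrs
    simp at hx'
    rwa [hx']
  refine hU ⟨_, ⟨p, hp, q, hq, hpq, rfl⟩, _, ⟨r, hr, s, hs, hrs, rfl⟩, fun e => h ?_, hx, hx'⟩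
  rw [← mem_line_iff_signedArea hpq, e]
  exact left_mem_affineSpan_pair ℝ r s

theorem add_mem_line {p q : EuclideanSpace ℝ (Fin 2)} {s t : ℝ} (h : s + t = 1) :
    s • p + t • q ∈ affineSpan ℝ {p, q} := by
  rw [mem_affineSpan_pair_iff_exists_lineMap_eq]
  refine ⟨t, ?_⟩
  obtain rfl : s = 1 - t := by linarith
  rw [AffineMap.lineMap_apply_module]

/-! ### Rational points of a projective frame -/

/-- The determinant of three vectors of homogeneous coordinates. -/
def bracket (u v w : Fin 3 → ℝ) : ℝ :=
  u 0 * (v 1 * w 2 - v 2 * w 1) - u 1 * (v 0 * w 2 - v 2 * w 0) + u 2 * (v 0 * w 1 - v 1 * w 0)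

theorem bracket_cons (a b c d e f g h i : ℝ) :
    bracket ![a, b, c] ![d, e, f] ![g, h, i] =
      a * (e * i - f * h) - b * (d * i - f * g) + c * (d * h - e * g) := by
  simp only [bracket, Matrix.cons_val]

/-- The value at `w` of the linear form with coefficients `α`; its kernel plays the role of the
line at infinity in homogeneous coordinates. -/
def weight (α w : Fin 3 → ℝ) : ℝ := α 0 * w 0 + α 1 * w 1 + α 2 * w 2

/-- A set of vectors of homogeneous coordinates is closed under line intersections if it contains
every vector off the line at infinity which represents the common point of two distinct lines, each
joining two points of the set. -/
def ProjectivelyClosed (α : Fin 3 → ℝ) (M : Set (Fin 3 → ℝ)) : Prop :=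
  ∀ ⦃u v u' v' w : Fin 3 → ℝ⦄, u ∈ M → v ∈ M → u' ∈ M → v' ∈ M → ∀ s t s' t' : ℝ,
    w = s • u + t • v → w = s' • u' + t' • v' → bracket u v u' ≠ 0 → weight α w ≠ 0 → w ∈ M

section Frame

variable {α : Fin 3 → ℝ} {M : Set (Fin 3 → ℝ)}

theorem weight_pos (hα : ∀ i, 0 < α i) {x y z : ℝ} (hx : 0 ≤ x) (hy : 0 ≤ y) (hz : 0 ≤ z)
    (h : 0 < x + y + z) : weight α ![x, y, z] ≠ 0 := by
  have h0 := mul_nonneg (hα 0).le hx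
  have h1 := mul_nonneg (hα 1).le hy
  have h2 := mul_nonneg (hα 2).le hz
  have : 0 < weight α ![x, y, z] := by
    simp only [weight, Matrix.cons_val]
    rcases hx.lt_or_eq with h' | rfl
    · have := mul_pos (hα 0) h'
      linarith
    rcases hy.lt_or_eq with h' | rfl
    · have := mul_pos (hα 1) h'
      linarith
    · have := mul_pos (hα 2) (by linarith : 0 < z)
      linarith
  exact this.ne'

/-- A projective version of addition of coordinates: the points `(1 : 0 : n)` and `(0 : 1 : n)` are
obtained for all natural numbers `n`. -/
theorem natural_mem (hM : ProjectivelyClosed α M) (hα : ∀ i, 0 < α i) (h1 : ![1, 0, 0] ∈ M)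
    (h2 : ![0, 1, 0] ∈ M) (h3 : ![0, 0, 1] ∈ M) (h4 : ![1, 1, 1] ∈ M) (n : ℕ) :
    ![1, 0, (n : ℝ)] ∈ M ∧ ![0, 1, (n : ℝ)] ∈ M := by
  have h110 : ![1, 1, 0] ∈ M := by
    refine hM h1 h2 h4 h3 1 1 1 (-1) ?_ ?_ ?_ (weight_pos hα ?_ ?_ ?_ ?_)
    iterate 2 · ext i; fin_cases i <;> simp
    all_goals norm_num [bracket_cons]
  have h011 : ![0, 1, 1] ∈ M := by
    refine hM h2 h3 h4 h1 1 1 1 (-1) ?_ ?_ ?_ (weight_pos hα ?_ ?_ ?_ ?_)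
    iterate 2 · ext i; fin_cases i <;> simp
    all_goals norm_num [bracket_cons]
  induction n with
  | zero => simpa using ⟨h1, h2⟩
  | succ n ih =>
    have hn : (0 : ℝ) ≤ n := n.cast_nonneg
    -- On the line `x = y`, the join of `(1 : 0 : n)` and `(0 : 1 : 1)` cuts out their sum.
    have h11 : ![1, 1, (n : ℝ) + 1] ∈ M := by
      refine hM h110 h3 ih.1 h011 1 (n + 1) 1 1 ?_ ?_ ?_ (weight_pos hα ?_ ?_ ?_ ?_)
      iterate 2 · ext i; fin_cases i <;> simp
      all_goals norm_num [bracket_cons]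
      all_goals linarith
    push_cast
    constructor
    · refine hM h1 h3 h11 h2 1 (n + 1) 1 (-1) ?_ ?_ ?_ (weight_pos hα ?_ ?_ ?_ ?_)
      iterate 2 · ext i; fin_cases i <;> simp
      all_goals norm_num [bracket_cons]
      all_goals linarith
    · refine hM h2 h3 h11 h1 1 (n + 1) 1 (-1) ?_ ?_ ?_ (weight_pos hα ?_ ?_ ?_ ?_)
      iterate 2 · ext i; fin_cases i <;> simp
      all_goals norm_num [bracket_cons]
      all_goals linarith

theorem positive_rational_mem_sides (hM : ProjectivelyClosed α M) (hα : ∀ i, 0 < α i)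
    (h1 : ![1, 0, 0] ∈ M) (h2 : ![0, 1, 0] ∈ M) (h3 : ![0, 0, 1] ∈ M) (h4 : ![1, 1, 1] ∈ M)
    {q : ℚ} (hq : 0 < q) : ![1, (q : ℝ), 0] ∈ M ∧ ![1, 0, (q : ℝ)] ∈ M := by
  obtain ⟨m, n, hm, hn, hmn⟩ : ∃ m n : ℕ, (0 : ℝ) < m ∧ (0 : ℝ) < n ∧ (q : ℝ) = n / m := by
    refine ⟨q.den, q.num.toNat, by exact_mod_cast q.den_pos, ?_, ?_⟩
    · have := Rat.num_pos.2 hq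
      exact_mod_cast (by omega : 0 < q.num.toNat)
    · have h := (Int.toNat_of_nonneg (Rat.num_pos.2 hq).le)
      rw [Rat.cast_def]
      congr 1
      exact_mod_cast h.symm
  have hm0 : m ≠ 0 := by rintro rfl; simp at hm
  have hn0 : n ≠ 0 := by rintro rfl; simp at hn
  -- `(1 : 0 : n)` and `(0 : 1 : m)` have the ratio `n : m`, read off on the side `z = 0`.
  have hA : ![(m : ℝ), n, m * n] ∈ M := by
    refine hM (natural_mem hM hα h1 h2 h3 h4 n).1 h2 (natural_mem hM hα h1 h2 h3 h4 m).2 h1 m n n m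
      ?_ ?_ ?_ (weight_pos hα ?_ ?_ ?_ ?_)
    iterate 2 · ext i; fin_cases i <;> simp [mul_comm]
    all_goals norm_num [bracket_cons]
    all_goals positivity
  have hB : ![1, (n : ℝ) / m, 0] ∈ M := by
    refine hM h1 h2 hA h3 1 (n / m) (1 / m) (-n)
      ?_ ?_ ?_ (weight_pos hα ?_ ?_ ?_ ?_)
    · ext i; fin_cases i <;> simp
    · ext i; fin_cases i <;> simp <;> field_simp
      ring
    all_goals norm_num [bracket_cons]
    all_goals first | positivity | simp [hm0, hn0]
  have hC : ![1, (n : ℝ) / m, n / m] ∈ M := by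
    refine hM hB h3 h1 (natural_mem hM hα h1 h2 h3 h4 1).2 1 (n / m) 1 (n / m)
      ?_ ?_ ?_ (weight_pos hα ?_ ?_ ?_ ?_)
    iterate 2 · ext i; fin_cases i <;> simp
    all_goals norm_num [bracket_cons]
    all_goals first | positivity | simp [hm0, hn0]
  have hD : ![1, 0, (n : ℝ) / m] ∈ M := by
    refine hM h1 h3 hC h2 1 (n / m) 1 (-(n / m))
      ?_ ?_ ?_ (weight_pos hα ?_ ?_ ?_ ?_)
    iterate 2 · ext i; fin_cases i <;> simp
    all_goals norm_num [bracket_cons]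
    all_goals first | positivity | simp [hm0, hn0]
  rw [hmn]
  exact ⟨hB, hD⟩

theorem positive_rational_mem (hM : ProjectivelyClosed α M) (hα : ∀ i, 0 < α i)
    (h1 : ![1, 0, 0] ∈ M) (h2 : ![0, 1, 0] ∈ M) (h3 : ![0, 0, 1] ∈ M) (h4 : ![1, 1, 1] ∈ M)
    {q r : ℚ} (hq : 0 < q) (hr : 0 < r) : ![1, (q : ℝ), (r : ℝ)] ∈ M := by
  have hq' : (0 : ℝ) < q := by exact_mod_cast hq
  have hr' : (0 : ℝ) < r := by exact_mod_cast hr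
  refine hM (positive_rational_mem_sides hM hα h1 h2 h3 h4 hq).1 h3
    (positive_rational_mem_sides hM hα h1 h2 h3 h4 hr).2 h2 1 r 1 q
      ?_ ?_ ?_ (weight_pos hα ?_ ?_ ?_ ?_)
  iterate 2 · ext i; fin_cases i <;> simp
  all_goals norm_num [bracket_cons]
  all_goals positivity

/-- Every rational vector off the line at infinity is reached, since it lies on the join of a
positive rational vector with any prescribed positive rational vector. -/
theorem rational_mem (hM : ProjectivelyClosed α M) (hα : ∀ i, 0 < α i)
    (h1 : ![1, 0, 0] ∈ M) (h2 : ![0, 1, 0] ∈ M) (h3 : ![0, 0, 1] ∈ M) (h4 : ![1, 1, 1] ∈ M)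
    (x y z : ℚ) (hw : weight α ![(x : ℝ), y, z] ≠ 0) : ![(x : ℝ), y, z] ∈ M := by
  have key : ∀ q r : ℚ, 0 < q → 0 < r → ∃ K c : ℝ, c ≠ 0 ∧ ∃ u ∈ M,
      ![(x : ℝ), y, z] = c • u - K • ![1, (q : ℝ), (r : ℝ)] := by
    intro q r hq hr
    obtain ⟨K, hK⟩ : ∃ K : ℚ, 0 < x + K ∧ 0 < y + K * q ∧ 0 < z + K * r := by
      refine ⟨|x| + 1 + |y| / q + |z| / r, ?_, ?_, ?_⟩
      · have := neg_abs_le x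
        have : 0 ≤ |y| / q := by positivity
        have : 0 ≤ |z| / r := by positivity
        linarith
      · have := neg_abs_le y
        have : (|x| + 1 + |y| / q + |z| / r) * q = (|x| + 1 + |z| / r) * q + |y| := by
          field_simp; ring
        have : 0 < (|x| + 1 + |z| / r) * q := by positivity
        linarith
      · have := neg_abs_le z
        have : (|x| + 1 + |y| / q + |z| / r) * r = (|x| + 1 + |y| / q) * r + |z| := by
          field_simp
        have : 0 < (|x| + 1 + |y| / q) * r := by positivity
        linarith
    have h := positive_rational_mem hM hα h1 h2 h3 h4 (div_pos hK.2.1 hK.1) (div_pos hK.2.2 hK.1)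
    have hc : (x : ℝ) + K ≠ 0 := by exact_mod_cast hK.1.ne'
    refine ⟨K, x + K, hc, _, h, ?_⟩
    ext i; fin_cases i <;> simp <;> field_simp <;> ring
  have step : ∀ q r q' r' : ℚ, 0 < q → 0 < r → 0 < q' → 0 < r' →
      bracket ![(x : ℝ), y, z] ![1, (q : ℝ), r] ![1, (q' : ℝ), r'] ≠ 0 → ![(x : ℝ), y, z] ∈ M := by
    intro q r q' r' hq hr hq' hr' hb
    obtain ⟨K, c, hc, u, hu, hx⟩ := key q r hq hr
    obtain ⟨K', c', hc', u', hu', hx'⟩ := key q' r' hq' hr'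
    refine hM hu (positive_rational_mem hM hα h1 h2 h3 h4 hq hr)
      (positive_rational_mem hM hα h1 h2 h3 h4 hq' hr') hu' c (-K) (-K') c' ?_ ?_ ?_ hw
    · rw [hx, neg_smul, sub_eq_add_neg]
    · rw [hx', neg_smul, sub_eq_add_neg, add_comm]
    · intro h0
      apply hb
      rw [hx]
      have : bracket (c • u - K • ![1, (q : ℝ), r]) ![1, (q : ℝ), r] ![1, (q' : ℝ), r'] =
          c * bracket u ![1, (q : ℝ), r] ![1, (q' : ℝ), r'] := by
        simp [bracket]; ring
      rw [this, h0, mul_zero]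
  -- No nonzero vector lies in all three planes spanned by two of these positive vectors.
  by_cases hxy : (x : ℝ) = y
  · by_cases hxz : (x : ℝ) = z
    · refine step 1 2 2 1 (by norm_num) (by norm_num) (by norm_num) (by norm_num) fun h => hw ?_
      simp only [bracket, weight, Matrix.cons_val] at h ⊢
      push_cast at h
      have : (x : ℝ) = 0 := by linarith
      rw [← hxz, ← hxy, this]
      ring
    · refine step 1 1 2 1 (by norm_num) (by norm_num) (by norm_num) (by norm_num) fun h => hxz ?_
      simp only [bracket, Matrix.cons_val] at h
      push_cast at h
      linarith
  · refine step 1 1 1 2 (by norm_num) (by norm_num) (by norm_num) (by norm_num) fun h => hxy ?_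
    simp only [bracket, Matrix.cons_val] at h
    push_cast at h
    linarith

end Frame

/-! ### A triangle with an inner point generates a dense set -/

/-- The point with homogeneous coordinates `w` in the projective frame whose base points are
`a, b, c` and whose unit point is `α 0 • a + α 1 • b + α 2 • c`. Vectors on the line at infinity are
sent to the junk value `0`. -/
noncomputable def framePoint (α : Fin 3 → ℝ) (a b c : EuclideanSpace ℝ (Fin 2)) (w : Fin 3 → ℝ) :
    EuclideanSpace ℝ (Fin 2) :=
  (α 0 * w 0 / weight α w) • a + (α 1 * w 1 / weight α w) • b + (α 2 * w 2 / weight α w) • c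

theorem weight_combination (α u v : Fin 3 → ℝ) (s t : ℝ) :
    weight α (s • u + t • v) = s * weight α u + t * weight α v := by
  simp only [weight, Pi.add_apply, Pi.smul_apply, smul_eq_mul]; ring

theorem framePoint_mem_line {α : Fin 3 → ℝ} {a b c : EuclideanSpace ℝ (Fin 2)} {u v : Fin 3 → ℝ}
    (hu : weight α u ≠ 0) (hv : weight α v ≠ 0) {s t : ℝ} (hw : weight α (s • u + t • v) ≠ 0) :
    framePoint α a b c (s • u + t • v) ∈
      affineSpan ℝ {framePoint α a b c u, framePoint α a b c v} := by
  have h : framePoint α a b c (s • u + t • v) =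
      (s * weight α u / weight α (s • u + t • v)) • framePoint α a b c u +
      (t * weight α v / weight α (s • u + t • v)) • framePoint α a b c v := by
    ext i
    simp only [framePoint, PiLp.add_apply, PiLp.smul_apply, Pi.add_apply, Pi.smul_apply,
      smul_eq_mul]
    field_simp
    ring
  rw [h]
  refine add_mem_line ?_
  rw [← add_div, ← weight_combination, div_self hw]

theorem projectivelyClosed_preimage {U : Set (EuclideanSpace ℝ (Fin 2))}
    (hU : lineIntersections U ⊆ U) {α : Fin 3 → ℝ} (hα : ∀ i, α i ≠ 0)
    {a b c : EuclideanSpace ℝ (Fin 2)} (habc : signedArea a b c ≠ 0) :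
    ProjectivelyClosed α {w | weight α w ≠ 0 ∧ framePoint α a b c w ∈ U} := by
  rintro u v u' v' w ⟨hu, hu'⟩ ⟨hv, hv'⟩ ⟨hx, hx'⟩ ⟨hy, hy'⟩ s t s' t' h1 h2 hb hw
  refine ⟨hw, mem_of_mem_lines hU hu' hv' hx' hy' ?_ ?_ ?_⟩
  · have hsum : ∀ w, weight α w ≠ 0 →
        α 0 * w 0 / weight α w + α 1 * w 1 / weight α w + α 2 * w 2 / weight α w = 1 := by
      intro w hw
      rw [← add_div, ← add_div]
      exact div_self hw
    unfold framePoint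
    rw [signedArea_combination a b c (hsum u hu) (hsum v hv) (hsum u' hx)]
    refine mul_ne_zero ?_ habc
    have : bracket u v u' * (α 0 * α 1 * α 2) / (weight α u * weight α v * weight α u') ≠ 0 :=
      div_ne_zero (mul_ne_zero hb (mul_ne_zero (mul_ne_zero (hα 0) (hα 1)) (hα 2)))
        (mul_ne_zero (mul_ne_zero hu hv) hx)
    convert this using 1
    unfold bracket
    field_simp
  · rw [h1] at hw ⊢
    exact framePoint_mem_line hu hv hw
  · rw [h2] at hw ⊢
    exact framePoint_mem_line hx hy hw

/-- `U` contains the vertices of a nondegenerate triangle and a point of its interior. -/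
def HasInteriorPoint (U : Set (EuclideanSpace ℝ (Fin 2))) : Prop :=
  ∃ a ∈ U, ∃ b ∈ U, ∃ c ∈ U, signedArea a b c ≠ 0 ∧
    ∃ l m n : ℝ, 0 < l ∧ 0 < m ∧ 0 < n ∧ l + m + n = 1 ∧ l • a + m • b + n • c ∈ U

theorem dense_of_hasInteriorPoint {U : Set (EuclideanSpace ℝ (Fin 2))}
    (hU : lineIntersections U ⊆ U) (h : HasInteriorPoint U) : Dense U := by
  obtain ⟨a, ha, b, hb, c, hc, habc, l, m, n, hl, hm, hn, hs, hp⟩ := h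
  set α : Fin 3 → ℝ := ![l, m, n] with hαdef
  have hα : ∀ i, 0 < α i := by
    intro i; fin_cases i <;> simpa [hαdef]
  have hM := projectivelyClosed_preimage hU (fun i => (hα i).ne') habc
  have hQ : ∀ x y z : ℚ, weight α ![(x : ℝ), y, z] ≠ 0 → framePoint α a b c ![(x : ℝ), y, z] ∈ U := by
    intro x y z hw
    refine (rational_mem hM hα ?_ ?_ ?_ ?_ x y z hw).2 <;>
    simp [weight, framePoint, hαdef, hs, hp, hl.ne', hm.ne', hn.ne', ha, hb, hc]
  have hcont : Continuous (weight α) := by unfold weight; fun_prop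
  rw [dense_iff_inter_open]
  rintro O hO ⟨p, hpO⟩
  obtain ⟨x, y, z, hxyz, rfl⟩ := exists_barycentric habc p
  set w₀ : Fin 3 → ℝ := ![x / l, y / m, z / n] with hw₀
  have hwt : weight α w₀ = 1 := by
    simp [weight, hαdef, hw₀, mul_div_cancel₀, hl.ne', hm.ne', hn.ne', hxyz]
  have hP : framePoint α a b c w₀ = x • a + y • b + z • c := by
    rw [framePoint, hwt]
    simp [hαdef, hw₀, mul_div_cancel₀, hl.ne', hm.ne', hn.ne']
  have hcP : ContinuousAt (framePoint α a b c) w₀ := by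
    unfold framePoint
    have h0 : weight α w₀ ≠ 0 := by rw [hwt]; exact one_ne_zero
    have := hcont.continuousAt (x := w₀)
    fun_prop (disch := assumption)
  have hnear : ∀ᶠ w in nhds w₀, weight α w ≠ 0 ∧ framePoint α a b c w ∈ O := by
    refine (hcont.continuousAt.eventually_ne (by rw [hwt]; exact one_ne_zero)).and ?_
    exact hcP.eventually (hO.mem_nhds (by rwa [hP]))
  have hdense : DenseRange (fun q : Fin 3 → ℚ => fun i => (q i : ℝ)) :=
    DenseRange.piMap fun _ => Rat.denseRange_cast
  obtain ⟨q, hq'⟩ := hdense.exists_mem_open isOpen_interior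
    ⟨w₀, mem_interior_iff_mem_nhds.2 hnear⟩
  have hw := interior_subset hq'
  have hq : (fun i => (q i : ℝ)) = ![(q 0 : ℝ), q 1, q 2] := by
    ext i; fin_cases i <;> rfl
  rw [hq] at hw
  exact ⟨_, hw.2, hQ _ _ _ hw.1⟩

/-! ### Quadrilaterals that are not parallelograms -/

theorem mem_line_of_eq {p q x : EuclideanSpace ℝ (Fin 2)} {s t : ℝ} (h : s + t = 1)
    (hx : x = s • p + t • q) : x ∈ affineSpan ℝ {p, q} :=
  hx ▸ add_mem_line h

/-- The point `d = l • a + m • b + n • c` lies across the side `a b`, and `l ≠ 1` says that the opposite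
sides `a d` and `b c` of the convex quadrilateral `a d b c` are not parallel. Their lines meet in a
point `e`; this point and two vertices of the quadrilateral span a triangle which contains the crossing
`f` of the diagonals in its interior. -/
theorem hasInteriorPoint_of_not_parallel {U : Set (EuclideanSpace ℝ (Fin 2))}
    (hU : lineIntersections U ⊆ U) {a b c : EuclideanSpace ℝ (Fin 2)} (ha : a ∈ U) (hb : b ∈ U)
    (hc : c ∈ U) (habc : signedArea a b c ≠ 0) {l m n : ℝ} (hs : l + m + n = 1)
    (hd : l • a + m • b + n • c ∈ U) (hl : 0 < l) (hm : 0 < m) (hn : n < 0) (hl1 : l ≠ 1) :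
    HasInteriorPoint U := by
  have hl1' : 1 - l ≠ 0 := sub_ne_zero.2 hl1.symm
  have hlm : 0 < l + m := by linarith
  obtain rfl : n = 1 - l - m := by linarith
  set d := l • a + m • b + (1 - l - m) • c with hd_def
  set e := (m / (1 - l)) • b + ((1 - l - m) / (1 - l)) • c with he_def
  set f := (l / (l + m)) • a + (m / (l + m)) • b with hf_def
  have he : e ∈ U := by
    refine mem_of_mem_lines hU hb hc ha hd (by rwa [signedArea_rotate]) (add_mem_line ?_)
      (mem_line_of_eq (s := -(l / (1 - l))) (t := 1 / (1 - l)) ?_ ?_)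
    · field_simp; ring
    · field_simp; ring
    · ext i
      simp only [e, d, PiLp.add_apply, PiLp.smul_apply, smul_eq_mul]
      field_simp; ring
  have hf : f ∈ U := by
    refine mem_of_mem_lines hU ha hb hc hd habc (add_mem_line ?_)
      (mem_line_of_eq (s := -((1 - l - m) / (l + m))) (t := 1 / (l + m)) ?_ ?_)
    · field_simp
    · field_simp; ring
    · ext i
      simp only [f, d, PiLp.add_apply, PiLp.smul_apply, smul_eq_mul]
      field_simp; ring
  -- For `l < 1` the point `e` lies beyond `d` and `b`, and for `l > 1` beyond `a` and `c`.
  rcases hl1.lt_or_gt with hlt | hgt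
  · refine ⟨e, he, a, ha, c, hc, ?_, (1 - l) / (l + m), l / (l + m), -((1 - l - m) / (l + m)), ?_,
      by positivity, ?_, ?_, ?_⟩
    · have : signedArea e a c = -(m / (1 - l)) * signedArea a b c := by
        simp only [e, signedArea, PiLp.add_apply, PiLp.smul_apply, smul_eq_mul]
        field_simp; ring
      rw [this]
      exact mul_ne_zero (neg_ne_zero.2 (div_ne_zero hm.ne' hl1')) habc
    · exact div_pos (by linarith) hlm
    · rw [← neg_div]; exact div_pos (by linarith) hlm
    · field_simp; ring
    · convert hf using 1
      ext i
      simp only [e, f, PiLp.add_apply, PiLp.smul_apply, smul_eq_mul]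
      field_simp; ring
  · refine ⟨e, he, d, hd, b, hb, ?_, (l - 1) / (l + m), 1 / (l + m), m / (l + m), ?_,
      by positivity, by positivity, ?_, ?_⟩
    · have : signedArea e d b = (l * (1 - l - m) / (1 - l)) * signedArea a b c := by
        simp only [e, d, signedArea, PiLp.add_apply, PiLp.smul_apply, smul_eq_mul]
        field_simp; ring
      rw [this]
      exact mul_ne_zero (div_ne_zero (mul_ne_zero hl.ne' hn.ne) hl1') habc
    · exact div_pos (by linarith) hlm
    · field_simp; ring
    · convert hf using 1
      ext i
      simp only [e, d, f, PiLp.add_apply, PiLp.smul_apply, smul_eq_mul]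
      field_simp; ring

theorem hasInteriorPoint_of_convex {U : Set (EuclideanSpace ℝ (Fin 2))}
    (hU : lineIntersections U ⊆ U) {a b c : EuclideanSpace ℝ (Fin 2)} (ha : a ∈ U) (hb : b ∈ U)
    (hc : c ∈ U) (habc : signedArea a b c ≠ 0) {l m n : ℝ} (hs : l + m + n = 1)
    (hd : l • a + m • b + n • c ∈ U) (hl : 0 < l) (hm : 0 < m) (hn : n < 0)
    (h : ¬(l = 1 ∧ m = 1)) : HasInteriorPoint U := by
  by_cases hl1 : l = 1
  · refine hasInteriorPoint_of_not_parallel hU hb ha hc ?_ (by linarith : m + l + n = 1) ?_ hm hl hn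
      fun hm1 => h ⟨hl1, hm1⟩
    · rwa [signedArea_swap, neg_ne_zero]
    · rwa [add_comm (m • b)]
  · exact hasInteriorPoint_of_not_parallel hU ha hb hc habc hs hd hl hm hn hl1

/-- If two barycentric coordinates are negative, then the vertex `a` lies inside the triangle formed by
`b`, `c` and the given point. -/
theorem hasInteriorPoint_of_two_neg {U : Set (EuclideanSpace ℝ (Fin 2))}
    {a b c : EuclideanSpace ℝ (Fin 2)} (ha : a ∈ U) (hb : b ∈ U)
    (hc : c ∈ U) (habc : signedArea a b c ≠ 0) {l m n : ℝ} (hs : l + m + n = 1)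
    (hd : l • a + m • b + n • c ∈ U) (hm : m < 0) (hn : n < 0) : HasInteriorPoint U := by
  have hl : 0 < l := by linarith
  obtain rfl : n = 1 - l - m := by linarith
  refine ⟨_, hd, b, hb, c, hc, ?_, 1 / l, -(m / l), -((1 - l - m) / l), by positivity, ?_, ?_, ?_,
    ?_⟩
  · have : signedArea (l • a + m • b + (1 - l - m) • c) b c = l * signedArea a b c := by
      simp only [signedArea, PiLp.add_apply, PiLp.smul_apply, smul_eq_mul]
      ring
    rw [this]
    exact mul_ne_zero hl.ne' habc
  · rw [← neg_div]; exact div_pos (by linarith) hl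
  · rw [← neg_div]; exact div_pos (by linarith) hl
  · field_simp; ring
  · convert ha using 1
    ext i
    simp only [PiLp.add_apply, PiLp.smul_apply, smul_eq_mul]
    field_simp; ring

/-- Barycentric coordinates of a point which forms, with the vertices of the reference triangle,
four points in general position that are not the vertices of a parallelogram. -/
def IsGenericCoord (l m n : ℝ) : Prop :=
  l ≠ 0 ∧ m ≠ 0 ∧ n ≠ 0 ∧ ¬(l = 1 ∧ m = 1) ∧ ¬(m = 1 ∧ n = 1) ∧ ¬(n = 1 ∧ l = 1)

theorem hasInteriorPoint_of_isGenericCoord {U : Set (EuclideanSpace ℝ (Fin 2))}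
    (hU : lineIntersections U ⊆ U) {a b c : EuclideanSpace ℝ (Fin 2)} (ha : a ∈ U) (hb : b ∈ U)
    (hc : c ∈ U) (habc : signedArea a b c ≠ 0) {l m n : ℝ} (hs : l + m + n = 1)
    (hd : l • a + m • b + n • c ∈ U) (h : IsGenericCoord l m n) : HasInteriorPoint U := by
  obtain ⟨hl, hm, hn, h1, h2, h3⟩ := h
  have hbca : signedArea b c a ≠ 0 := by rwa [signedArea_rotate]
  have hcab : signedArea c a b ≠ 0 := by rwa [signedArea_rotate, signedArea_rotate]
  have hd' : m • b + n • c + l • a ∈ U := by rwa [add_rotate] at hd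
  have hd'' : n • c + l • a + m • b ∈ U := by rwa [add_rotate] at hd'
  rcases hl.lt_or_gt with hl | hl <;> rcases hm.lt_or_gt with hm | hm <;>
    rcases hn.lt_or_gt with hn | hn
  · linarith
  · exact hasInteriorPoint_of_two_neg hc ha hb hcab (by linarith) hd'' hl hm
  · exact hasInteriorPoint_of_two_neg hb hc ha hbca (by linarith) hd' hn hl
  · exact hasInteriorPoint_of_convex hU hb hc ha hbca (by linarith) hd' hm hn hl h2
  · exact hasInteriorPoint_of_two_neg ha hb hc habc hs hd hm hn
  · exact hasInteriorPoint_of_convex hU hc ha hb hcab (by linarith) hd'' hn hl hm h3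
  · exact hasInteriorPoint_of_convex hU ha hb hc habc hs hd hl hm hn h1
  · exact ⟨a, ha, b, hb, c, hc, habc, l, m, n, hl, hm, hn, hs, hd⟩

/-- The barycentric coordinates of a point with respect to four triangles formed by the vertices of a
parallelogram `a, b, c, a + b - c`: unless the point is one of the vertices or the centre, they are
generic for at least one triangle. -/
theorem exists_isGenericCoord {l m n : ℝ} (hs : l + m + n = 1) (e1 : ¬(l = 1 ∧ m = 0))
    (e2 : ¬(l = 0 ∧ m = 1)) (e3 : ¬(l = 0 ∧ m = 0)) (e4 : ¬(l = 1 ∧ m = 1))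
    (e5 : ¬(l = 1 / 2 ∧ m = 1 / 2)) :
    IsGenericCoord l m n ∨ IsGenericCoord (l + n) (m + n) (-n) ∨
      IsGenericCoord (l - m) (n + m) m ∨ IsGenericCoord (m - l) (n + l) l := by
  obtain rfl : n = 1 - l - m := by linarith
  rw [show l + (1 - l - m) = 1 - m by ring, show m + (1 - l - m) = 1 - l by ring,
    show 1 - l - m + m = 1 - l by ring, show 1 - l - m + l = 1 - m by ring]
  by_cases hl : l = 0
  · subst hl; unfold IsGenericCoord; grind
  by_cases hm : m = 0
  · subst hm; unfold IsGenericCoord; grind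
  by_cases hn : 1 - l - m = 0
  · obtain rfl : m = 1 - l := by linarith
    unfold IsGenericCoord; grind
  by_cases h1 : m = 1 ∧ 1 - l - m = 1
  · obtain ⟨rfl, h⟩ := h1
    obtain rfl : l = -1 := by linarith
    norm_num [IsGenericCoord]
  by_cases h2 : 1 - l - m = 1 ∧ l = 1
  · obtain ⟨h, rfl⟩ := h2
    obtain rfl : m = -1 := by linarith
    norm_num [IsGenericCoord]
  exact Or.inl ⟨hl, hm, hn, e4, h1, h2⟩

/-- A point other than the vertices and the centre of the parallelogram `a c b d` forms a generic
quadrilateral with three of its vertices. -/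
theorem hasInteriorPoint_of_parallelogram {U : Set (EuclideanSpace ℝ (Fin 2))}
    (hU : lineIntersections U ⊆ U) {a b c : EuclideanSpace ℝ (Fin 2)} (ha : a ∈ U) (hb : b ∈ U)
    (hc : c ∈ U) (habc : signedArea a b c ≠ 0) (hd : a + b - c ∈ U)
    {e : EuclideanSpace ℝ (Fin 2)} (he : e ∈ U)
    (hne : e ∉ ({a, b, c, a + b - c, (1 / 2 : ℝ) • a + (1 / 2 : ℝ) • b} :
      Set (EuclideanSpace ℝ (Fin 2)))) :
    HasInteriorPoint U := by
  obtain ⟨l, m, n, hs, rfl⟩ := exists_barycentric habc e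
  have habd : signedArea a b (a + b - c) ≠ 0 := by
    convert neg_ne_zero.2 habc using 1
    simp only [signedArea, PiLp.add_apply, PiLp.sub_apply]; ring
  have hacd : signedArea a c (a + b - c) ≠ 0 := by
    convert neg_ne_zero.2 habc using 1
    simp only [signedArea, PiLp.add_apply, PiLp.sub_apply]; ring
  have hbcd : signedArea b c (a + b - c) ≠ 0 := by
    convert habc using 1
    simp only [signedArea, PiLp.add_apply, PiLp.sub_apply]; ring
  by_cases h1 : IsGenericCoord l m n
  · exact hasInteriorPoint_of_isGenericCoord hU ha hb hc habc hs he h1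
  by_cases h2 : IsGenericCoord (l + n) (m + n) (-n)
  · exact hasInteriorPoint_of_isGenericCoord hU ha hb hd habd (by linarith)
      (by convert he using 1; module) h2
  by_cases h3 : IsGenericCoord (l - m) (n + m) m
  · exact hasInteriorPoint_of_isGenericCoord hU ha hc hd hacd (by linarith)
      (by convert he using 1; module) h3
  by_cases h4 : IsGenericCoord (m - l) (n + l) l
  · exact hasInteriorPoint_of_isGenericCoord hU hb hc hd hbcd (by linarith)
      (by convert he using 1; module) h4
  refine absurd (exists_isGenericCoord hs ?_ ?_ ?_ ?_ ?_) (by tauto) <;> rintro ⟨rfl, rfl⟩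
  · exact hne (by simp [show n = 0 by linarith])
  · exact hne (by simp [show n = 0 by linarith])
  · exact hne (by simp [show n = 1 by linarith])
  · exact hne (by simp [show n = -1 by linarith, sub_eq_add_neg])
  · exact hne (by simp [show n = 0 by linarith])

/-! ### The operation `lineIntersections` on sets -/

theorem left_mem_lineIntersections {U : Set (EuclideanSpace ℝ (Fin 2))}
    {a b c : EuclideanSpace ℝ (Fin 2)} (ha : a ∈ U) (hb : b ∈ U) (hc : c ∈ U)
    (habc : signedArea a b c ≠ 0) : a ∈ lineIntersections U := by
  have hab : a ≠ b := by rintro rfl; exact habc (signedArea_self_left _ _)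
  have hac : a ≠ c := by
    rintro rfl; rw [← signedArea_rotate, signedArea_rotate] at habc
    exact habc (by simp [signedArea])
  refine ⟨_, ⟨a, ha, b, hb, hab, rfl⟩, _, ⟨a, ha, c, hc, hac, rfl⟩, fun h => habc ?_,
    left_mem_affineSpan_pair ℝ a b, left_mem_affineSpan_pair ℝ a c⟩
  rw [← mem_line_iff_signedArea hab, h]
  exact right_mem_affineSpan_pair ℝ a c

/-- Points of a non-collinear set are kept by `lineIntersections`. -/
theorem subset_lineIntersections {U : Set (EuclideanSpace ℝ (Fin 2))}
    {a b c : EuclideanSpace ℝ (Fin 2)} (ha : a ∈ U) (hb : b ∈ U) (hc : c ∈ U)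
    (habc : signedArea a b c ≠ 0) : U ⊆ lineIntersections U := by
  intro x hx
  by_cases h1 : signedArea x a b = 0
  · by_cases h2 : signedArea x b c = 0
    · by_cases h3 : signedArea x c a = 0
      · refine absurd ?_ habc
        have : signedArea a b c = signedArea x a b + signedArea x b c + signedArea x c a := by
          unfold signedArea; ring
        rw [this, h1, h2, h3]; norm_num
      · exact left_mem_lineIntersections hx hc ha h3
    · exact left_mem_lineIntersections hx hb hc h2
  · exact left_mem_lineIntersections hx ha hb h1

theorem connectingLines_mono {S T : Set (EuclideanSpace ℝ (Fin 2))} (h : S ⊆ T) :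
    connectingLines S ⊆ connectingLines T := by
  rintro L ⟨p, hp, q, hq, hpq, rfl⟩
  exact ⟨p, h hp, q, h hq, hpq, rfl⟩

theorem lineIntersections_mono {S T : Set (EuclideanSpace ℝ (Fin 2))} (h : S ⊆ T) :
    lineIntersections S ⊆ lineIntersections T := by
  rintro x ⟨L, hL, M, hM, hne, hx, hx'⟩
  exact ⟨L, connectingLines_mono h hL, M, connectingLines_mono h hM, hne, hx, hx'⟩

theorem lineIntersections_iUnion_subset {F : ℕ → Set (EuclideanSpace ℝ (Fin 2))}
    (hF : Monotone F) : lineIntersections (⋃ i, F i) ⊆ ⋃ i, lineIntersections (F i) := by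
  rintro x ⟨L, ⟨p, hp, q, hq, hpq, rfl⟩, M, ⟨r, hr, s, hs, hrs, rfl⟩, hne, hx, hx'⟩
  simp only [Set.mem_iUnion] at hp hq hr hs ⊢
  obtain ⟨i, hp⟩ := hp
  obtain ⟨j, hq⟩ := hq
  obtain ⟨k, hr⟩ := hr
  obtain ⟨l, hs⟩ := hs
  have hi : i ≤ i + j + k + l := by omega
  have hj : j ≤ i + j + k + l := by omega
  have hk : k ≤ i + j + k + l := by omega
  have hl : l ≤ i + j + k + l := by omega
  exact ⟨i + j + k + l, _, ⟨p, hF hi hp, q, hF hj hq, hpq, rfl⟩, _,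
    ⟨r, hF hk hr, s, hF hl hs, hrs, rfl⟩, hne, hx, hx'⟩

theorem finite_lineIntersections {S : Set (EuclideanSpace ℝ (Fin 2))} (hS : S.Finite) :
    (lineIntersections S).Finite := by
  have hL : (connectingLines S).Finite := by
    refine (Set.Finite.image2 (fun p q => affineSpan ℝ {p, q}) hS hS).subset ?_
    rintro L ⟨p, hp, q, hq, -, rfl⟩
    exact ⟨p, hp, q, hq, rfl⟩
  refine ((hL.prod hL).biUnion (t := fun LM => {x | LM.1 ≠ LM.2 ∧ x ∈ LM.1 ∧ x ∈ LM.2})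
    ?_).subset ?_
  · rintro ⟨L, M⟩ ⟨⟨p, -, q, -, hpq, rfl⟩, ⟨r, -, s, -, hrs, rfl⟩⟩
    refine Set.Subsingleton.finite ?_
    rintro x ⟨hne, hx, hx'⟩ y ⟨-, hy, hy'⟩
    by_contra hxy
    exact hne ((affineSpan_pair_eq_of_mem_of_mem_of_ne hx hy hxy).symm.trans
      (affineSpan_pair_eq_of_mem_of_mem_of_ne hx' hy' hxy))
  · rintro x ⟨L, hL, M, hM, hne, hx, hx'⟩
    exact Set.mem_biUnion (x := (L, M)) ⟨hL, hM⟩ ⟨hne, hx, hx'⟩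

theorem lineIntersections_eq_empty {S : Set (EuclideanSpace ℝ (Fin 2))}
    (hS : ∀ p ∈ S, ∀ q ∈ S, ∀ r ∈ S, signedArea p q r = 0) : lineIntersections S = ∅ := by
  rw [Set.eq_empty_iff_forall_notMem]
  rintro x ⟨L, ⟨p, hp, q, hq, hpq, rfl⟩, M, ⟨r, hr, s, hs, hrs, rfl⟩, hne, -, -⟩
  exact hne (line_eq_of_mem hpq hrs (hS p hp q hq r hr) (hS p hp q hq s hs)).symm

/-! ### Near-pencils and points in general position -/

/-- If all points of `S` other than `a` lie on the line `b c`, the only connecting lines are this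
line and the lines joining `a` to its points; they meet in points of `S` only. -/
theorem lineIntersections_subset_of_nearPencil {S : Set (EuclideanSpace ℝ (Fin 2))}
    {a b c : EuclideanSpace ℝ (Fin 2)} (ha : a ∈ S) (hbc : b ≠ c)
    (hS : ∀ x ∈ S, x = a ∨ signedArea b c x = 0) : lineIntersections S ⊆ S := by
  have key : ∀ L ∈ connectingLines S, L = affineSpan ℝ {b, c} ∨
      a ∈ L ∧ ∃ q ∈ S, q ∈ L ∧ q ∈ affineSpan ℝ {b, c} := by
    rintro L ⟨p, hp, q, hq, hpq, rfl⟩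
    rcases hS p hp with rfl | hp'
    · rcases hS q hq with rfl | hq'
      · exact absurd rfl hpq
      · exact Or.inr ⟨left_mem_affineSpan_pair ℝ p q, q, hq, right_mem_affineSpan_pair ℝ p q,
          (mem_line_iff_signedArea hbc q).2 hq'⟩
    · rcases hS q hq with rfl | hq'
      · exact Or.inr ⟨right_mem_affineSpan_pair ℝ p q, p, hp, left_mem_affineSpan_pair ℝ p q,
          (mem_line_iff_signedArea hbc p).2 hp'⟩
      · exact Or.inl (line_eq_of_mem hbc hpq hp' hq')
  have uniq : ∀ L ∈ connectingLines S, ∀ x y, x ≠ y → x ∈ L → y ∈ L → affineSpan ℝ {x, y} = L := by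
    rintro L ⟨p, hp, q, hq, hpq, rfl⟩ x y hxy hx hy
    exact affineSpan_pair_eq_of_mem_of_mem_of_ne hx hy hxy
  rintro x ⟨L, hL, M, hM, hne, hxL, hxM⟩
  by_contra hx
  have hxa : x ≠ a := fun h => hx (h ▸ ha)
  rcases key L hL with rfl | ⟨haL, q, hq, hqL, hqbc⟩
  · rcases key M hM with rfl | ⟨haM, q, hq, hqM, hqbc⟩
    · exact hne rfl
    · have hxq : x ≠ q := fun h => hx (h ▸ hq)
      exact hne ((uniq _ hL x q hxq hxL hqbc).symm.trans (uniq _ hM x q hxq hxM hqM))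
  · rcases key M hM with rfl | ⟨haM, -⟩
    · have hxq : x ≠ q := fun h => hx (h ▸ hq)
      exact hne ((uniq _ hL x q hxq hxL hqL).symm.trans (uniq _ hM x q hxq hxM hqbc))
    · exact hne ((uniq _ hL x a hxa hxL haL).symm.trans (uniq _ hM x a hxa hxM haM))

/-- Some four points of `S` are in general position: three of them form a nondegenerate triangle, and
no barycentric coordinate of the fourth one vanishes. -/
def HasGeneralQuadruple (S : Set (EuclideanSpace ℝ (Fin 2))) : Prop :=
  ∃ p ∈ S, ∃ q ∈ S, ∃ r ∈ S, signedArea p q r ≠ 0 ∧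
    ∃ l m n : ℝ, l + m + n = 1 ∧ l ≠ 0 ∧ m ≠ 0 ∧ n ≠ 0 ∧ l • p + m • q + n • r ∈ S

/-- Two vertices of a triangle and inner points of the two sides at the third vertex are in general
position. -/
theorem hasGeneralQuadruple_of_two_sides {S : Set (EuclideanSpace ℝ (Fin 2))}
    {a b c : EuclideanSpace ℝ (Fin 2)} (ha : a ∈ S) (hb : b ∈ S) (habc : signedArea a b c ≠ 0)
    {m n l n' : ℝ} (hmn : m + n = 1) (hm : m ≠ 0) (hn : n ≠ 0) (he : m • b + n • c ∈ S)
    (hln : l + n' = 1) (hl : l ≠ 0) (hn' : n' ≠ 0) (he' : l • a + n' • c ∈ S) :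
    HasGeneralQuadruple S := by
  obtain rfl : m = 1 - n := by linarith
  obtain rfl : l = 1 - n' := by linarith
  refine ⟨a, ha, b, hb, _, he, ?_, 1 - n', -(n' * (1 - n) / n), n' / n, ?_, hl,
    neg_ne_zero.2 (div_ne_zero (mul_ne_zero hn' hm) hn), div_ne_zero hn' hn, ?_⟩
  · have : signedArea a b ((1 - n) • b + n • c) = n * signedArea a b c := by
      simp only [signedArea, PiLp.add_apply, PiLp.smul_apply, smul_eq_mul]; ring
    rw [this]
    exact mul_ne_zero hn habc
  · field_simp; ring
  · convert he' using 1
    ext i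
    simp only [PiLp.add_apply, PiLp.smul_apply, smul_eq_mul]
    field_simp; ring

theorem nearPencil_or_hasGeneralQuadruple_of_side {S : Set (EuclideanSpace ℝ (Fin 2))}
    {a b c : EuclideanSpace ℝ (Fin 2)} (ha : a ∈ S) (hb : b ∈ S) (hc : c ∈ S)
    (habc : signedArea a b c ≠ 0) {m n : ℝ} (hmn : m + n = 1) (hm : m ≠ 0) (hn : n ≠ 0)
    (he : m • b + n • c ∈ S) :
    lineIntersections S ⊆ S ∨ HasGeneralQuadruple S := by
  by_contra! hcon
  obtain ⟨h1, h2⟩ := hcon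
  have hbc : b ≠ c := by
    rintro rfl; rw [← signedArea_rotate] at habc; exact habc (signedArea_self_left _ _)
  refine h1 (lineIntersections_subset_of_nearPencil ha hbc fun x hx => ?_)
  obtain ⟨l', m', n', hs, rfl⟩ := exists_barycentric habc x
  by_cases hl' : l' = 0
  · right
    subst hl'
    obtain rfl : m' = 1 - n' := by linarith
    simp only [signedArea, PiLp.add_apply, PiLp.smul_apply, smul_eq_mul]; ring
  by_cases hm' : m' = 0 <;> by_cases hn' : n' = 0
  · left
    subst hm' hn'
    obtain rfl : l' = 1 := by linarith
    simp
  · subst hm'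
    exact absurd (hasGeneralQuadruple_of_two_sides ha hb habc hmn hm hn he
      (by linarith : l' + n' = 1) hl' hn' (by simpa using hx)) h2
  · subst hn'
    refine absurd (hasGeneralQuadruple_of_two_sides ha hc (b := c) (c := b) ?_
      ((add_comm n m).trans hmn) hn hm (by rwa [add_comm])
      (by linarith : l' + m' = 1) hl' hm' (by simpa using hx)) h2
    rw [signedArea_rotate, signedArea_rotate, ← signedArea_rotate, signedArea_swap]
    exact neg_ne_zero.2 habc
  · exact absurd ⟨a, ha, b, hb, c, hc, habc, l', m', n', hs, hl', hm', hn', hx⟩ h2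

/-- A non-collinear set is fixed by `lineIntersections`, being a near-pencil, or contains four points
in general position. -/
theorem nearPencil_or_hasGeneralQuadruple {S : Set (EuclideanSpace ℝ (Fin 2))}
    {a b c : EuclideanSpace ℝ (Fin 2)} (ha : a ∈ S) (hb : b ∈ S) (hc : c ∈ S)
    (habc : signedArea a b c ≠ 0) : lineIntersections S ⊆ S ∨ HasGeneralQuadruple S := by
  by_cases h : ∀ x ∈ S, x = a ∨ x = b ∨ x = c
  · have hbc : b ≠ c := by
      rintro rfl; rw [← signedArea_rotate] at habc; exact habc (signedArea_self_left _ _)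
    refine Or.inl (lineIntersections_subset_of_nearPencil ha hbc fun x hx => ?_)
    rcases h x hx with rfl | rfl | rfl
    · exact Or.inl rfl
    · exact Or.inr (by simp [signedArea])
    · exact Or.inr (by unfold signedArea; ring)
  push Not at h
  obtain ⟨x, hx, hxa, hxb, hxc⟩ := h
  obtain ⟨l, m, n, hs, rfl⟩ := exists_barycentric habc x
  have hbca : signedArea b c a ≠ 0 := by rwa [signedArea_rotate]
  have hcab : signedArea c a b ≠ 0 := by rwa [signedArea_rotate, signedArea_rotate]
  by_cases hl : l = 0
  · subst hl
    have hm : m ≠ 0 := by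
      rintro rfl; exact hxc (by simp [show n = 1 by linarith])
    have hn : n ≠ 0 := by
      rintro rfl; exact hxb (by simp [show m = 1 by linarith])
    exact nearPencil_or_hasGeneralQuadruple_of_side ha hb hc habc (by linarith) hm hn
      (by simpa using hx)
  by_cases hm : m = 0
  · subst hm
    have hn : n ≠ 0 := by
      rintro rfl; exact hxa (by simp [show l = 1 by linarith])
    exact nearPencil_or_hasGeneralQuadruple_of_side hb hc ha hbca (by linarith) hn hl
      (by simpa [add_comm] using hx)
  by_cases hn : n = 0
  · subst hn
    exact nearPencil_or_hasGeneralQuadruple_of_side hc ha hb hcab (by linarith) hl hm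
      (by simpa using hx)
  exact Or.inr ⟨a, ha, b, hb, c, hc, habc, l, m, n, hs, hl, hm, hn, hx⟩

/-! ### Sets of finite and of infinite order -/

/-- Four points in general position are generic unless they form a parallelogram, and then a further
point of the infinite set gives a generic quadruple. -/
theorem hasInteriorPoint_of_infinite {U : Set (EuclideanSpace ℝ (Fin 2))}
    (hU : lineIntersections U ⊆ U) (hinf : U.Infinite) (h : HasGeneralQuadruple U) :
    HasInteriorPoint U := by
  obtain ⟨a, ha, b, hb, c, hc, habc, l, m, n, hs, hl, hm, hn, hd⟩ := h
  have hbca : signedArea b c a ≠ 0 := by rwa [signedArea_rotate]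
  have hcab : signedArea c a b ≠ 0 := by rwa [signedArea_rotate, signedArea_rotate]
  have para : ∀ {a b c : EuclideanSpace ℝ (Fin 2)}, a ∈ U → b ∈ U → c ∈ U →
      signedArea a b c ≠ 0 → a + b - c ∈ U → HasInteriorPoint U := by
    intro a b c ha hb hc habc hd
    obtain ⟨e, he, hne⟩ := (hinf.sdiff (Set.toFinite
      {a, b, c, a + b - c, (1 / 2 : ℝ) • a + (1 / 2 : ℝ) • b})).nonempty
    exact hasInteriorPoint_of_parallelogram hU ha hb hc habc hd he hne
  by_cases h1 : l = 1 ∧ m = 1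
  · refine para ha hb hc habc ?_
    obtain ⟨rfl, rfl⟩ := h1
    obtain rfl : n = -1 := by linarith
    convert hd using 1
    module
  by_cases h2 : m = 1 ∧ n = 1
  · refine para hb hc ha hbca ?_
    obtain ⟨rfl, rfl⟩ := h2
    obtain rfl : l = -1 := by linarith
    convert hd using 1
    module
  by_cases h3 : n = 1 ∧ l = 1
  · refine para hc ha hb hcab ?_
    obtain ⟨rfl, rfl⟩ := h3
    obtain rfl : m = -1 := by linarith
    convert hd using 1
    module
  exact hasInteriorPoint_of_isGenericCoord hU ha hb hc habc hs hd ⟨hl, hm, hn, h1, h2, h3⟩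

theorem lineOrder_eq_top_iff (S : Set (EuclideanSpace ℝ (Fin 2))) :
    lineOrder S = ⊤ ↔ ∀ n, lineIntersections^[n + 1] S ≠ lineIntersections^[n] S := by
  simp only [lineOrder, sInf_eq_top, Set.mem_ofPred_eq]
  constructor
  · intro h n hn
    exact ENat.natCast_ne_top (n + 1) (h _ ⟨n + 1, n.succ_pos, by simpa using hn, rfl⟩)
  · rintro h _ ⟨n, hn, he, rfl⟩
    obtain ⟨n, rfl⟩ := Nat.exists_eq_add_of_lt hn
    simp only [zero_add, Nat.add_sub_cancel] at he
    exact absurd he (h n)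

theorem finite_iterate {S : Set (EuclideanSpace ℝ (Fin 2))} (hS : S.Finite) (n : ℕ) :
    (lineIntersections^[n] S).Finite := by
  induction n with
  | zero => exact hS
  | succ n ih =>
    rw [Function.iterate_succ_apply']
    exact finite_lineIntersections ih

theorem not_dense_of_iterate_eq {S : Set (EuclideanSpace ℝ (Fin 2))} (hS : S.Finite) {n : ℕ}
    (hn : lineIntersections^[n + 1] S = lineIntersections^[n] S) :
    ¬Dense (⋃ i : ℕ, lineIntersections^[i] S) := by
  have hstable : ∀ k, lineIntersections^[n + k] S = lineIntersections^[n] S := by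
    intro k
    induction k with
    | zero => rfl
    | succ k ih =>
      rw [← add_assoc, Function.iterate_succ_apply', ih,
        ← Function.iterate_succ_apply' lineIntersections, hn]
  have hfin : (⋃ i : ℕ, lineIntersections^[i] S).Finite := by
    refine ((Set.finite_le_nat n).biUnion fun i _ => finite_iterate hS i).subset ?_
    refine Set.iUnion_subset fun i => ?_
    rcases le_total i n with h | h
    · exact Set.subset_biUnion_of_mem (u := fun i => lineIntersections^[i] S) h
    · obtain ⟨k, rfl⟩ := Nat.exists_eq_add_of_le h
      rw [hstable]
      exact Set.subset_biUnion_of_mem (u := fun i => lineIntersections^[i] S) (le_refl n)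
  intro hd
  have huniv := hfin.isClosed.closure_eq ▸ hd.closure_eq
  rw [huniv] at hfin
  exact Set.infinite_univ hfin

theorem dense_of_iterate_ne {S : Set (EuclideanSpace ℝ (Fin 2))}
    (h : ∀ n, lineIntersections^[n + 1] S ≠ lineIntersections^[n] S) :
    Dense (⋃ i : ℕ, lineIntersections^[i] S) := by
  obtain ⟨a, ha, b, hb, c, hc, habc⟩ :
      ∃ a ∈ S, ∃ b ∈ S, ∃ c ∈ S, signedArea a b c ≠ 0 := by
    by_contra! hcol
    refine h 1 ?_
    have h1 : lineIntersections S = ∅ := lineIntersections_eq_empty hcol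
    have h2 : lineIntersections ∅ = ∅ := lineIntersections_eq_empty (by simp)
    simp [h1, h2]
  have hsub := subset_lineIntersections ha hb hc habc
  have hmono : Monotone fun i => lineIntersections^[i] S := by
    refine monotone_nat_of_le_succ fun n => ?_
    rw [Function.iterate_succ_apply]
    exact Monotone.iterate (fun _ _ => lineIntersections_mono) n hsub
  have hclosed : lineIntersections (⋃ i : ℕ, lineIntersections^[i] S) ⊆
      ⋃ i : ℕ, lineIntersections^[i] S := by
    refine (lineIntersections_iUnion_subset hmono).trans (Set.iUnion_subset fun i => ?_)
    rw [← Function.iterate_succ_apply' lineIntersections]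
    exact Set.subset_iUnion (fun i => lineIntersections^[i] S) (i + 1)
  have hinf : (⋃ i : ℕ, lineIntersections^[i] S).Infinite := by
    intro hfin
    have hstrict : StrictMono fun i => lineIntersections^[i] S :=
      strictMono_nat_of_lt_succ fun n => lt_of_le_of_ne (hmono n.le_succ) (h n).symm
    exact Set.infinite_of_injective_forall_mem hstrict.injective
      (fun i => Set.mem_powerset (Set.subset_iUnion (fun i => lineIntersections^[i] S) i))
      hfin.powerset
  have hgen : HasGeneralQuadruple S :=
    (nearPencil_or_hasGeneralQuadruple ha hb hc habc).resolve_left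
      fun h' => h 0 (h'.antisymm hsub)
  obtain ⟨p, hp, q, hq, r, hr, hpqr, l, m, n, hs, hl, hm, hn, hd⟩ := hgen
  have hS : S ⊆ ⋃ i : ℕ, lineIntersections^[i] S :=
    Set.subset_iUnion (fun i => lineIntersections^[i] S) 0
  exact dense_of_hasInteriorPoint hclosed (hasInteriorPoint_of_infinite hclosed hinf
    ⟨p, hS hp, q, hS hq, r, hS hr, hpqr, l, m, n, hs, hl, hm, hn, hS hd⟩)

theorem theorem1p1 (S : Set (EuclideanSpace ℝ (Fin 2))) (hS : S.Finite) :
    lineOrder S = ⊤ ↔ Dense (⋃ i : ℕ, lineIntersections^[i] S) := by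
  rw [lineOrder_eq_top_iff]
  exact ⟨dense_of_iterate_ne, fun hd n hn => not_dense_of_iterate_eq hS hn hd⟩
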